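/- Let $k\ge 1$ and let $\mathcal N=(N^{(i)})_{i\in\mathbb N}$, $N^{(i)}=(N^{(i)}_1,\dots,N^{(i)}_k)$, be an unbounded sequence of points of $\mathbb R^k$ with positive coordinates, such that for some $j\in\{1,\dots,k\}$ the sequence of coordinates $(N^{(i)}_j)_{i}$ converges to a real number that is not an integer. Then there exists $0<\mu<1$ such that for all but finitely many $i$, writing $(N_1,\dots,N_k)=N^{(i)}$, and for every $\xi=(\xi_1,\dots,\xi_k)\in\mathbb R^k$, there are integers $q_1,\dots,q_k$ and $p$, not all zero, with $$|q_1\xi_1+\dots+q_k\xi_k-p|\le \mu\,(N_1\cdots N_k)^{-1},\qquad |q_l|<\mu N_l\quad(1\le l\le k).$$ -/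

import Mathlib

open Filter Topology

/-- Solubility of the `μ`-improved Dirichlet system for `ξ ∈ ℝ^k` with bounds `N = (N_1, …, N_k)`:
there are integers `q_1, …, q_k` and `p`, not all zero, such that
`|q_1 ξ_1 + ⋯ + q_k ξ_k - p| ≤ μ (N_1 ⋯ N_k)⁻¹` and `|q_i| < μ N_i` for all `i`. -/
def ImprovedDirichletSoluble {k : ℕ} (μ : ℝ) (N ξ : Fin k → ℝ) : Prop :=
  ∃ (q : Fin k → ℤ) (p : ℤ), ¬ (q = 0 ∧ p = 0) ∧
    |(∑ i, (q i : ℝ) * ξ i) - (p : ℝ)| ≤ μ * (∏ i, N i)⁻¹ ∧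
    ∀ i, |(q i : ℝ)| < μ * N i

/-! Let `c` be the non-integer limit of `N_j` and `m = ⌊c⌋`. An integer with `|q_j| < m + 1` already
has `|q_j| ≤ m`, which is below `μ N_j` for `μ` near 1 and late terms. So Minkowski's theorem may
use the larger bound `m + 1 > c` for `q_j`; the volume gained pays for the factors `μ` elsewhere. -/

/-- **Minkowski's theorem on linear forms**, strict version. -/
theorem exists_int_ne_zero_abs_mulVec_lt {ι : Type*} [Fintype ι] [DecidableEq ι]
    (A : Matrix ι ι ℝ) (hA : A.det ≠ 0) (a : ι → ℝ) (ha : ∀ i, 0 < a i)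
    (hlt : |A.det| < ∏ i, a i) :
    ∃ x : ι → ℤ, x ≠ 0 ∧ ∀ i, |A.mulVec (fun l => (x l : ℝ)) i| < a i := by
  set b := Pi.basisFun ℝ ι
  set S : Set (ι → ℝ) := A.toLin' ⁻¹' Set.univ.pi fun i => Set.Ioo (-a i) (a i)
  have hmem (x : ι → ℝ) : x ∈ S ↔ ∀ i, |A.mulVec x i| < a i := by
    simp [S, abs_lt]
  have hvol : MeasureTheory.volume S = ENNReal.ofReal (|A.det|⁻¹ * ∏ i, (2 * a i)) := by
    rw [MeasureTheory.Measure.addHaar_preimage_linearMap _ (by simpa using hA),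
      Real.volume_pi_Ioo, ← ENNReal.ofReal_prod_of_nonneg fun i _ => by linarith [ha i],
      ← ENNReal.ofReal_mul (abs_nonneg _), LinearMap.det_toLin', abs_inv]
    simp only [sub_neg_eq_add, two_mul]
  have : Countable (Submodule.span ℤ (Set.range b)).toAddSubgroup :=
    inferInstanceAs (Countable (Submodule.span ℤ (Set.range b)))
  obtain ⟨x, hx0, hxS⟩ :=
    MeasureTheory.exists_ne_zero_mem_lattice_of_measure_mul_two_pow_lt_measure
      (μ := MeasureTheory.volume) (L := (Submodule.span ℤ (Set.range b)).toAddSubgroup)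
      (s := S) (ZSpan.isAddFundamentalDomain b _)
      (fun x hx => by
        rw [hmem] at hx ⊢
        simpa only [Matrix.mulVec_neg, Pi.neg_apply, abs_neg] using hx)
      ((convex_pi fun i _ => convex_Ioo _ _).linear_preimage _)
      (by
        -- The lattice is `ℤ^ι`, of covolume 1; the powers of 2 cancel.
        rw [ZSpan.volume_fundamentalDomain, hvol, Module.finrank_fintype_fun_eq_card,
          show Matrix.of b = 1 by
            ext i j; simp [b, Matrix.one_apply, Pi.single_apply, eq_comm],
          Matrix.det_one, abs_one, ENNReal.ofReal_one, one_mul,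
          Finset.prod_mul_distrib, Finset.prod_const, Finset.card_univ,
          ← ENNReal.ofReal_ofNat, ← ENNReal.ofReal_pow zero_le_two]
        have hd : 0 < |A.det| := abs_pos.2 hA
        refine (ENNReal.ofReal_lt_ofReal_iff_of_nonneg (by positivity)).2 ?_
        rw [inv_mul_eq_div, lt_div_iff₀ hd]
        gcongr)
  have hint (i : ι) : ∃ n : ℤ, (n : ℝ) = (x : ι → ℝ) i := by
    have := (b.mem_span_iff_repr_mem ℤ (x : ι → ℝ)).1 x.2 i
    simpa [b] using this
  choose n hn using hint
  refine ⟨n, fun h => hx0 ?_, ?_⟩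
  · ext i
    simp [← hn, h]
  · simpa only [hn] using (hmem _).1 hxS

/-- Minkowski's theorem for the system consisting of `q · ξ - p` and the coordinates of `q`. -/
theorem exists_int_abs_sum_sub_lt {k : ℕ} (ξ a : Fin k → ℝ) (d : ℝ) (ha : ∀ i, 0 < a i)
    (hd : 0 < d) (hlt : 1 < (∏ i, a i) * d) :
    ∃ (q : Fin k → ℤ) (p : ℤ), ¬ (q = 0 ∧ p = 0) ∧
      |(∑ i, (q i : ℝ) * ξ i) - p| < d ∧ ∀ i, |(q i : ℝ)| < a i := by
  set A : Matrix (Fin k ⊕ Unit) (Fin k ⊕ Unit) ℝ :=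
    Matrix.fromBlocks 1 0 (Matrix.of fun _ i => ξ i) (-1)
  have hdet : A.det = -1 := by
    simp [A]
  obtain ⟨x, hx0, hx⟩ := exists_int_ne_zero_abs_mulVec_lt A (by simp [hdet])
    (Sum.elim a fun _ => d) (by rintro (i | i) <;> simp [ha, hd]) (by simpa [hdet] using hlt)
  refine ⟨fun i => x (.inl i), x (.inr ()), fun h => hx0 ?_, ?_, fun i => ?_⟩
  · ext (i | i)
    · exact congrFun h.1 i
    · exact h.2
  · simpa [A, Matrix.mulVec, dotProduct, Matrix.neg_apply, mul_comm, sub_eq_add_neg] using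
      hx (.inr ())
  · simpa [A, Matrix.mulVec, dotProduct, Matrix.one_apply] using hx (.inl i)

/-- If no integer lies in `[μ N_j, m + 1)`, the bound on `q_j` may be relaxed to `m + 1`, which
leaves room to improve the other bounds. -/
theorem improvedDirichletSoluble_of_lt {k : ℕ} {μ : ℝ} (hμ : 0 < μ) {N : Fin k → ℝ}
    (hN : ∀ i, 0 < N i) (j : Fin k) (m : ℤ) (hm : (m : ℝ) < μ * N j)
    (hlt : N j < μ ^ k * (m + 1)) (ξ : Fin k → ℝ) : ImprovedDirichletSoluble μ N ξ := by
  have hm1 : (0 : ℝ) < m + 1 := pos_of_mul_pos_right ((hN j).trans hlt) (by positivity)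
  have hprod : 0 < ∏ i, N i := Finset.prod_pos fun i _ => hN i
  obtain ⟨q, p, h0, hp, hq⟩ := exists_int_abs_sum_sub_lt ξ
    (Function.update (fun i => μ * N i) j (m + 1)) (μ * (∏ i, N i)⁻¹)
    (fun i => by
      by_cases h : i = j
      · subst h; simpa using hm1
      · simpa [h] using mul_pos hμ (hN i))
    (by positivity)
    (by
      -- One `μ` comes from the linear form, `k - 1` from the bounds other than the `j`-th.
      have hk : μ * μ ^ (Finset.univ \ {j}).card = μ ^ k := by
        rw [← pow_succ', Finset.card_sdiff_of_subset (by simp), Finset.card_univ,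
          Fintype.card_fin, Finset.card_singleton, Nat.sub_add_cancel (Fin.pos j)]
      have hrest : 0 < ∏ i ∈ Finset.univ \ {j}, N i := Finset.prod_pos fun i _ => hN i
      rw [Finset.prod_update_of_mem (Finset.mem_univ j), Finset.prod_mul_distrib,
        Finset.prod_const, Finset.prod_eq_mul_prod_sdiff_singleton_of_mem (Finset.mem_univ j) N,
        ← div_eq_mul_inv, mul_div_assoc', lt_div_iff₀ (mul_pos (hN j) hrest), one_mul]
      calc N j * ∏ i ∈ Finset.univ \ {j}, N i
          < μ ^ k * (m + 1) * ∏ i ∈ Finset.univ \ {j}, N i := by gcongr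
        _ = _ := by rw [← hk]; ring)
  refine ⟨q, p, h0, hp.le, fun i => ?_⟩
  by_cases h : i = j
  · subst h
    have hqm : |q i| < m + 1 := by
      have := hq i
      rw [Function.update_self] at this
      exact_mod_cast this
    refine lt_of_le_of_lt ?_ hm
    exact_mod_cast Int.lt_add_one_iff.1 hqm
  · simpa [h] using hq i

theorem theorem1p5 (k : ℕ) (N : ℕ → Fin k → ℝ)
    (hpos : ∀ (i : ℕ) (j : Fin k), 0 < N i j)
    (hunb : ¬ Bornology.IsBounded (Set.range N))
    (hlim : ∃ (j : Fin k) (c : ℝ),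
      Tendsto (fun i : ℕ => N i j) atTop (𝓝 c) ∧ ∀ m : ℤ, c ≠ (m : ℝ)) :
    ∃ μ : ℝ, 0 < μ ∧ μ < 1 ∧
      ∀ᶠ i in (atTop : Filter ℕ), ∀ ξ : Fin k → ℝ, ImprovedDirichletSoluble μ (N i) ξ := by
  obtain ⟨j, c, hc, hcm⟩ := hlim
  -- Both inequalities are strict at `μ = 1`, so they persist for `μ` slightly below 1.
  have hlow : (⌊c⌋ : ℝ) < 1 * c := by
    simpa using lt_of_le_of_ne (Int.floor_le c) (hcm _).symm
  have hupp : c < 1 ^ k * ((⌊c⌋ : ℝ) + 1) := by simp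
  have hev : ∀ᶠ μ : ℝ in 𝓝[<] 1, 0 < μ ∧ μ < 1 ∧ (⌊c⌋ : ℝ) < μ * c ∧
      c < μ ^ k * ((⌊c⌋ : ℝ) + 1) := by
    have h1 : Tendsto (fun μ : ℝ => μ * c) (𝓝 1) (𝓝 (1 * c)) :=
      (continuous_id.mul continuous_const).tendsto 1
    have h2 : Tendsto (fun μ : ℝ => μ ^ k * ((⌊c⌋ : ℝ) + 1)) (𝓝 1)
        (𝓝 (1 ^ k * ((⌊c⌋ : ℝ) + 1))) :=
      ((continuous_pow k).mul continuous_const).tendsto 1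
    filter_upwards [self_mem_nhdsWithin, nhdsWithin_le_nhds (lt_mem_nhds zero_lt_one),
      nhdsWithin_le_nhds (h1.eventually_const_lt hlow),
      nhdsWithin_le_nhds (h2.eventually_const_lt hupp)] with μ h h' h'' h'''
    exact ⟨h', h, h'', h'''⟩
  obtain ⟨μ, hμ0, hμ1, hμlow, hμupp⟩ := hev.exists
  refine ⟨μ, hμ0, hμ1, ?_⟩
  filter_upwards [(hc.const_mul μ).eventually_const_lt hμlow, hc.eventually_lt_const hμupp]
    with i hi hi' ξ
  exact improvedDirichletSoluble_of_lt hμ0 (hpos i) j ⌊c⌋ hi hi' ξ
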